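/- \textbf{Inverse theorem for the $U^3$-norm on $\mathbb{F}_5^n$.} For every real $\delta > 0$ there is a constant $c = c(\delta) > 0$, depending only on $\delta$, such that the following holds for every integer $n \geq 0$. Let $G := \mathbb{F}_5^n$, let $\omega := e^{2\pi i/5}$, and write $\mathbb{E}_{x \in X} := |X|^{-1}\sum_{x \in X}$ for the average over a finite set $X$. Let $f : G \to [-1,1]$ be a function with $\Vert f \Vert_{U^3} \geq \delta$, where the Gowers $U^3$-norm $\Vert f \Vert_{U^3} \geq 0$ is defined by \[ \Vert f \Vert_{U^3}^8 := \mathbb{E}_{x,h_1,h_2,h_3 \in G}\, f(x)f(x+h_1)f(x+h_2)f(x+h_3)f(x+h_1+h_2)f(x+h_1+h_3)f(x+h_2+h_3)f(x+h_1+h_2+h_3). \] Then there are an $n \times n$ matrix $M$ over $\mathbb{F}_5$ and a vector $r \in \mathbb{F}_5^n$ such that \[ \bigl|\mathbb{E}_{x \in G}\, f(x)\,\omega^{x^T M x + r^T x}\bigr| \geq c. \] -/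

import Mathlib

open scoped BigOperators Matrix

/-- The average of `f(x) f(x+h₁) f(x+h₂) f(x+h₃) f(x+h₁+h₂) f(x+h₁+h₃) f(x+h₂+h₃) f(x+h₁+h₂+h₃)`
over all `h₁, h₂, h₃, x` in the finite abelian group `G`. -/
noncomputable def cubeAverage {G : Type*} [AddCommGroup G] [Fintype G] (f : G → ℝ) : ℝ :=
  𝔼 h₁ : G, 𝔼 h₂ : G, 𝔼 h₃ : G, 𝔼 x : G,
    f x * f (x + h₁) * f (x + h₂) * f (x + h₃) *
      f (x + h₁ + h₂) * f (x + h₁ + h₃) * f (x + h₂ + h₃) * f (x + h₁ + h₂ + h₃)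

/-- The Gowers `U³`-norm of a real-valued function: the eighth root of the cube average. -/
noncomputable def gowersU3Norm {G : Type*} [AddCommGroup G] [Fintype G] (f : G → ℝ) : ℝ :=
  cubeAverage f ^ (1 / 8 : ℝ)

/-- The cube average is non-negative, so that its eighth root is a genuine one. -/
theorem cubeAverage_nonneg {G : Type*} [AddCommGroup G] [Fintype G] (f : G → ℝ) :
    0 ≤ cubeAverage f := by
  unfold cubeAverage
  refine Finset.expect_nonneg fun h₁ _ => Finset.expect_nonneg fun h₂ _ => ?_
  set F : G → ℝ := fun x => f x * f (x + h₁) * f (x + h₂) * f (x + h₁ + h₂) with hF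
  have key : (𝔼 h₃ : G, 𝔼 x : G,
      f x * f (x + h₁) * f (x + h₂) * f (x + h₃) *
      f (x + h₁ + h₂) * f (x + h₁ + h₃) * f (x + h₂ + h₃) * f (x + h₁ + h₂ + h₃)) =
      (𝔼 x : G, F x) * 𝔼 y : G, F y := by
    rw [Finset.expect_comm, Finset.expect_mul]
    refine Finset.expect_congr rfl fun x _ => ?_
    rw [Finset.mul_expect]
    refine Fintype.expect_equiv (Equiv.addLeft x) _ _ fun h₃ => ?_
    simp only [hF, Equiv.coe_addLeft]
    rw [add_right_comm x h₁ h₃, add_right_comm x h₂ h₃, add_right_comm (x + h₁) h₂ h₃,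
      add_right_comm x h₁ h₃]
    ring
  rw [key]
  exact mul_self_nonneg _

theorem gowersU3Norm_pow_eight {G : Type*} [AddCommGroup G] [Fintype G] (f : G → ℝ) :
    gowersU3Norm f ^ 8 = cubeAverage f := by
  unfold gowersU3Norm
  rw [← Real.rpow_natCast, ← Real.rpow_mul (cubeAverage_nonneg f)]
  norm_num

/-- The quadratic phase `x ↦ ω ^ (xᵀ M x + rᵀ x)` on `𝔽₅ⁿ`, where `ω = exp (2πi/5)`:
`ZMod.stdAddChar j = exp (2πi j / 5)` for `j` in `ZMod 5`. -/
noncomputable def quadraticPhase {n : ℕ} (M : Matrix (Fin n) (Fin n) (ZMod 5))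
    (r : Fin n → ZMod 5) (x : Fin n → ZMod 5) : ℂ :=
  ZMod.stdAddChar (x ⬝ᵥ (M *ᵥ x) + r ⬝ᵥ x)

/-! For a genuine quadratic phase, every multiplicative derivative `x ↦ f x * f (x + h)` is a
character whose frequency is affine in `h`. The proof recovers such an affine dependence from a
large `U³`-norm, and then integrates it.

The cube average is an average over `h` of `U²`-type averages of the derivatives, so many
derivatives have a large Fourier coefficient, at some `φ h` (`exists_deriv_coeff`). Cauchy–Schwarz
type bounds force the graph of `φ` to have large additive energy (`energy_graph`).
Balog–Szemerédi–Gowers extracts a dense part of the graph with small doubling, Freiman's theorem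
puts it in a small subspace, and linear algebra then makes `φ` agree with an affine map `h ↦ M h +
b` on a dense set (`exists_affine_deriv_coeff`).

A function `M h` can be the derivative of a quadratic only if `M` is symmetric. A further
Cauchy–Schwarz argument shows that `Mᵀ - M` has bounded rank, so `M` can be replaced by its
symmetric part at the cost of a pigeonholing (`exists_symmetric`). The resulting bilinear phase is a
second derivative of a quadratic phase; absorbing it into `f` leaves a `U²`-type average, and its
large Fourier coefficient is the desired correlation (`exists_quadraticPhase`). -/

open scoped ComplexConjugate Pointwise

set_option linter.unusedSectionVars false

/-! ### Fourier analysis over 𝔽₅ and the `U²` inverse theorem. -/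

section Fourier

variable {ι : Type*} [Fintype ι]

/-- The character `x ↦ exp (2πi (r ⬝ x) / 5)`. -/
noncomputable def phase (r x : ι → ZMod 5) : ℂ := ZMod.stdAddChar (r ⬝ᵥ x)

lemma phase_comm (r x : ι → ZMod 5) : phase r x = phase x r := by
  rw [phase, dotProduct_comm, phase]

lemma phase_add (r x y : ι → ZMod 5) : phase r (x + y) = phase r x * phase r y := by
  simp [phase, dotProduct_add, AddChar.map_add_eq_mul]

lemma phase_add_left (r s x : ι → ZMod 5) : phase (r + s) x = phase r x * phase s x := by
  simp [phase, add_dotProduct, AddChar.map_add_eq_mul]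

lemma conj_phase (r x : ι → ZMod 5) : conj (phase r x) = phase r (-x) := by
  simp [phase, AddChar.map_neg_eq_conj]

lemma phase_neg_left (r x : ι → ZMod 5) : phase (-r) x = phase r (-x) := by
  simp [phase]

lemma phase_sub (r x y : ι → ZMod 5) : phase r (x - y) = phase r x * conj (phase r y) := by
  rw [conj_phase, ← phase_add, sub_eq_add_neg]

@[simp] lemma norm_phase (r x : ι → ZMod 5) : ‖phase r x‖ = 1 := by
  simp [phase]

@[simp] lemma phase_zero (r : ι → ZMod 5) : phase r 0 = 1 := by simp [phase]

variable [DecidableEq ι]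

lemma expect_phase (r : ι → ZMod 5) :
    𝔼 x, phase r x = if r = 0 then 1 else 0 := by
  let ψ : AddChar (ι → ZMod 5) ℂ :=
    { toFun := phase r
      map_zero_eq_one' := phase_zero r
      map_add_eq_mul' := phase_add r }
  have h : ψ = 0 ↔ r = 0 := by
    constructor
    · intro h
      funext i
      have h1 : phase r (Pi.single i 1) = 1 := DFunLike.congr_fun h (Pi.single i 1)
      rw [phase, dotProduct_single, mul_one, ← AddChar.map_zero_eq_one (ZMod.stdAddChar (N := 5))]
        at h1
      exact ZMod.injective_stdAddChar h1
    · rintro rfl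
      ext x
      simp [ψ, phase]
  have := AddChar.expect_eq_ite ψ
  simp only [h] at this
  exact this

/-- The Fourier coefficient of `f` at `r`. -/
noncomputable def coeff (f : (ι → ZMod 5) → ℂ) (r : ι → ZMod 5) : ℂ := 𝔼 x, f x * phase r x

lemma sum_phase (x : ι → ZMod 5) :
    ∑ r, phase r x = if x = 0 then (Fintype.card (ι → ZMod 5) : ℂ) else 0 := by
  have h := expect_phase x
  simp_rw [phase_comm x] at h
  rw [← Fintype.card_mul_expect, h]
  simp

lemma fourier_inversion (f : (ι → ZMod 5) → ℂ) (x : ι → ZMod 5) :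
    f x = ∑ r, coeff f r * phase r (-x) := by
  simp_rw [coeff, Finset.expect_mul, ← Finset.expect_sum_comm, mul_assoc, ← phase_add,
    ← Finset.mul_sum, sum_phase, add_neg_eq_zero, mul_ite, mul_zero,
    Fintype.expect_eq_sum_div_card]
  rw [Finset.sum_ite_eq' Finset.univ x]
  simp

lemma parseval (f : (ι → ZMod 5) → ℂ) : ∑ r, ‖coeff f r‖ ^ 2 = 𝔼 x, ‖f x‖ ^ 2 := by
  have h : ∑ r, coeff f r * conj (coeff f r) = 𝔼 x, f x * conj (f x) := by
    have h1 (x) : f x * conj (f x) = ∑ r, f x * phase r x * conj (coeff f r) := by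
      conv_lhs => rw [show conj (f x) = _ from congrArg conj (fourier_inversion f x), map_sum,
        Finset.mul_sum]
      refine Finset.sum_congr rfl fun r _ => ?_
      rw [map_mul, conj_phase, neg_neg]
      ring
    simp_rw [h1]
    rw [Finset.expect_sum_comm]
    refine Finset.sum_congr rfl fun r _ => ?_
    rw [← Finset.expect_mul, ← coeff]
  simp_rw [Complex.mul_conj'] at h
  exact_mod_cast h

lemma expect_le_one_of_le_one {f : (ι → ZMod 5) → ℂ} (hf : ∀ x, ‖f x‖ ≤ 1) :
    𝔼 x, ‖f x‖ ^ 2 ≤ 1 :=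
  Finset.expect_le Finset.univ_nonempty fun x _ => pow_le_one₀ (norm_nonneg _) (hf x)

lemma expect_comp_add_right {M : Type*} [AddCommMonoid M] [Module ℚ≥0 M] {G : Type*}
    [AddCommGroup G] [Fintype G] (f : G → M) (a : G) : 𝔼 x, f (x + a) = 𝔼 x, f x :=
  Fintype.expect_equiv (Equiv.addRight a) _ _ fun _ => rfl

lemma trilinear_eq (a c u : (ι → ZMod 5) → ℂ) :
    𝔼 x, 𝔼 h, a x * c (x + h) * u h = ∑ r, coeff c r * coeff a (-r) * coeff u (-r) := by
  have h1 (x h) : a x * c (x + h) * u h =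
      ∑ r, coeff c r * (a x * phase (-r) x) * (u h * phase (-r) h) := by
    rw [fourier_inversion c (x + h), Finset.mul_sum, Finset.sum_mul]
    refine Finset.sum_congr rfl fun r _ => ?_
    rw [neg_add, phase_add, phase_neg_left, phase_neg_left]
    ring
  simp_rw [h1, Finset.expect_sum_comm, ← Finset.mul_expect, ← Finset.expect_mul,
    ← Finset.mul_expect]
  rfl

/-- In the Fourier expansion, one factor is bounded by `η`; the other two are square-summable by
Parseval. -/
lemma norm_trilinear_le {a c u : (ι → ZMod 5) → ℂ} (ha : ∀ x, ‖a x‖ ≤ 1) (hu : ∀ x, ‖u x‖ ≤ 1)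
    {η : ℝ} (hη : ∀ r, ‖coeff c r‖ ≤ η) : ‖𝔼 x, 𝔼 h, a x * c (x + h) * u h‖ ≤ η := by
  have hη0 : 0 ≤ η := (norm_nonneg _).trans (hη 0)
  have key (g : (ι → ZMod 5) → ℂ) (hg : ∀ x, ‖g x‖ ≤ 1) : ∑ r, ‖coeff g (-r)‖ ^ 2 ≤ 1 := by
    rw [Fintype.sum_equiv (Equiv.neg _) (fun r => ‖coeff g (-r)‖ ^ 2) (fun r => ‖coeff g r‖ ^ 2)
      fun _ => rfl, parseval]
    exact expect_le_one_of_le_one hg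
  rw [trilinear_eq]
  calc _ ≤ ∑ r, ‖coeff c r * coeff a (-r) * coeff u (-r)‖ := norm_sum_le _ _
    _ ≤ ∑ r, η * ((‖coeff a (-r)‖ ^ 2 + ‖coeff u (-r)‖ ^ 2) / 2) := by
      refine Finset.sum_le_sum fun r _ => ?_
      rw [norm_mul, norm_mul, mul_assoc]
      refine mul_le_mul (hη r) ?_ (by positivity) hη0
      nlinarith [sq_nonneg (‖coeff a (-r)‖ - ‖coeff u (-r)‖)]
    _ = η * ((∑ r, ‖coeff a (-r)‖ ^ 2 + ∑ r, ‖coeff u (-r)‖ ^ 2) / 2) := by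
      rw [← Finset.mul_sum, ← Finset.sum_div, Finset.sum_add_distrib]
    _ ≤ η * 1 := by
      gcongr
      linarith [key a ha, key u hu]
    _ = η := mul_one η

/-- The change of variables `h ↦ x + h`, up to a sign in `x`, exchanges the roles of `c` and `u`. -/
lemma norm_trilinear_le' {a c u : (ι → ZMod 5) → ℂ} (ha : ∀ x, ‖a x‖ ≤ 1) (hc : ∀ x, ‖c x‖ ≤ 1)
    {η : ℝ} (hη : ∀ r, ‖coeff u r‖ ≤ η) : ‖𝔼 x, 𝔼 h, a x * c (x + h) * u h‖ ≤ η := by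
  have : 𝔼 x, 𝔼 h, a x * c (x + h) * u h = 𝔼 x, 𝔼 h, a (-x) * u (x + h) * c h := by
    rw [Fintype.expect_equiv (Equiv.neg _) (fun x => 𝔼 h, a (-x) * u (x + h) * c h)
      (fun x => 𝔼 h, a x * u (-x + h) * c h) (fun x => by simp)]
    refine Finset.expect_congr rfl fun x _ => ?_
    refine Fintype.expect_equiv (Equiv.addLeft x) _ _ fun h => ?_
    simp only [Equiv.coe_addLeft, neg_add_cancel_left]
    ring
  rw [this]
  exact norm_trilinear_le (fun x => ha (-x)) hc hη

lemma coeff_comp_add (f : (ι → ZMod 5) → ℂ) (a r : ι → ZMod 5) :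
    ‖coeff (fun x => f (a + x)) r‖ = ‖coeff f r‖ := by
  have : coeff f r = phase r a * coeff (fun x => f (a + x)) r := by
    rw [coeff, coeff, Finset.mul_expect]
    refine (Fintype.expect_equiv (Equiv.addLeft a) _ _ fun h => ?_).symm
    simp only [Equiv.coe_addLeft, phase_add]
    ring
  rw [this, norm_mul, norm_phase, one_mul]

/-- For fixed `x` the average over `h` and `k` is a trilinear form in translates of `g₂`, `g₃`,
`g₄`. Translation preserves the size of Fourier coefficients, so the largest coefficient of `g₄`
works for all `x` at once. -/
lemma exists_coeff_of_box {g₁ g₂ g₃ g₄ : (ι → ZMod 5) → ℂ} (h₁ : ∀ x, ‖g₁ x‖ ≤ 1)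
    (h₂ : ∀ x, ‖g₂ x‖ ≤ 1) (h₃ : ∀ x, ‖g₃ x‖ ≤ 1) :
    ∃ r, ‖𝔼 x, 𝔼 h, 𝔼 k, g₁ x * g₂ (x + h) * g₃ (x + k) * g₄ (x + h + k)‖ ≤ ‖coeff g₄ r‖ := by
  obtain ⟨r, hr⟩ := Finite.exists_max fun r => ‖coeff g₄ r‖
  refine ⟨r, (RCLike.norm_expect_le (K := ℂ)).trans (Finset.expect_le Finset.univ_nonempty fun x _ => ?_)⟩
  have : 𝔼 h, 𝔼 k, g₁ x * g₂ (x + h) * g₃ (x + k) * g₄ (x + h + k) =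
      g₁ x * 𝔼 h, 𝔼 k, g₂ (x + h) * g₄ (x + (h + k)) * g₃ (x + k) := by
    simp_rw [Finset.mul_expect, add_assoc]
    refine Finset.expect_congr rfl fun h _ => Finset.expect_congr rfl fun k _ => by ring
  rw [this, norm_mul]
  refine (mul_le_of_le_one_left (norm_nonneg _) (h₁ x)).trans ?_
  refine norm_trilinear_le (fun h => h₂ (x + h)) (c := fun y => g₄ (x + y))
    (fun k => h₃ (x + k)) fun s => ?_
  rw [coeff_comp_add]
  exact hr s

end Fourier

/-! ### The Balog–Szemerédi–Gowers theorem. -/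

section BalogSzemerediGowers

variable {G : Type*} [AddCommGroup G] [DecidableEq G]

/-- The number of representations of `d` as a difference of two elements of `A`. -/
def diffCount (A : Finset G) (d : G) : ℕ := (A.filter fun a => a - d ∈ A).card

variable [Fintype G]

lemma sum_diffCount (A : Finset G) : ∑ d, (diffCount A d : ℝ) = (A.card : ℝ) ^ 2 := by
  have h (a : G) : ∑ d : G, (if a - d ∈ A then (1 : ℝ) else 0) = A.card := by
    rw [Fintype.sum_equiv (Equiv.subLeft a) (fun d => if a - d ∈ A then (1 : ℝ) else 0)
      (fun d => if d ∈ A then (1 : ℝ) else 0) fun _ => rfl]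
    simp
  simp_rw [diffCount, Finset.card_filter, Nat.cast_sum, Nat.cast_ite, Nat.cast_one, Nat.cast_zero]
  rw [Finset.sum_comm]
  simp_rw [h]
  simp [sq]

lemma card_common_translates (A : Finset G) (p q : G) :
    (Finset.univ.filter fun x => p - x ∈ A ∧ q - x ∈ A).card = diffCount A (p - q) := by
  refine Finset.card_bij' (fun x _ => p - x) (fun a _ => p - a) ?_ ?_ ?_ ?_
  · intro x hx
    simp only [Finset.mem_filter, Finset.mem_univ, true_and] at hx ⊢
    refine ⟨hx.1, ?_⟩
    convert hx.2 using 1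
    abel
  · intro a ha
    simp only [Finset.mem_filter, Finset.mem_univ, true_and] at ha ⊢
    refine ⟨by simpa using ha.1, ?_⟩
    convert ha.2 using 1
    abel
  · intro x _
    simp
  · intro x _
    simp

/-- A dense fibre `A ∩ (A + x)` in which almost all differences are popular. -/
lemma exists_translate_popular (A : Finset G) (hA : A.Nonempty) {c : ℝ} (hc : 0 < c)
    (hE : c * (A.card : ℝ) ^ 3 ≤ ∑ d, (diffCount A d : ℝ) ^ 2) :
    ∃ D ⊆ A, c / 4 * A.card < D.card ∧
      16 * (((D ×ˢ D).filter fun z => (diffCount A (z.1 - z.2) : ℝ) < c / 32 * A.card).card : ℝ) ≤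
        (D.card : ℝ) ^ 2 := by
  set a : ℝ := (A.card : ℝ) with ha
  have ha0 : 0 < a := by simpa [ha] using hA
  let D : G → Finset G := fun x => A.filter fun p => p - x ∈ A
  let bad : G → ℝ := fun x =>
    (((D x ×ˢ D x).filter fun z => (diffCount A (z.1 - z.2) : ℝ) < c / 32 * a).card : ℝ)
  -- A pair `(p, q)` lies in `D x ×ˢ D x` for at most `diffCount A (p - q)` values of `x`, which is
  -- small when the pair is bad.
  have hbad : ∑ x, bad x ≤ c / 32 * a * a ^ 2 := by
    let P := (A ×ˢ A).filter fun z => (diffCount A (z.1 - z.2) : ℝ) < c / 32 * a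
    have h1 (x : G) : bad x = ∑ z ∈ P,
          if z.1 - x ∈ A ∧ z.2 - x ∈ A then (1 : ℝ) else 0 := by
      rw [Finset.sum_boole, Finset.filter_filter]
      simp only [bad, D]
      congr 2
      ext z
      simp only [Finset.mem_filter, Finset.mem_product]
      tauto
    simp_rw [h1]
    rw [Finset.sum_comm]
    calc _ ≤ ∑ z ∈ P, c / 32 * a := by
          refine Finset.sum_le_sum fun z hz => ?_
          rw [Finset.sum_boole, card_common_translates]
          exact (Finset.mem_filter.1 hz).2.le
      _ ≤ ∑ z ∈ A ×ˢ A, c / 32 * a :=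
          Finset.sum_le_sum_of_subset_of_nonneg (Finset.filter_subset _ _)
            fun _ _ _ => by positivity
      _ = c / 32 * a * a ^ 2 := by
          rw [Finset.sum_const, Finset.card_product, nsmul_eq_mul]
          push_cast
          ring
  -- The three sums are at least `c a³`, at most `c a³ / 2` and equal to `c a³ / 4`. One `x` with a
  -- positive summand serves both conclusions.
  have hpos : 0 < ∑ x, ((diffCount A x : ℝ) ^ 2 - 16 * bad x - c / 4 * a * diffCount A x) := by
    rw [Finset.sum_sub_distrib, Finset.sum_sub_distrib, ← Finset.mul_sum, ← Finset.mul_sum,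
      sum_diffCount, ← ha]
    have : 0 < c * a ^ 3 := by positivity
    nlinarith
  obtain ⟨x, -, hx⟩ := Finset.exists_lt_of_sum_lt (by simpa using hpos :
    ∑ _x : G, (0 : ℝ) < ∑ x, ((diffCount A x : ℝ) ^ 2 - 16 * bad x - c / 4 * a * diffCount A x))
  have hb0 : 0 ≤ bad x := Nat.cast_nonneg _
  have hr0 : (0 : ℝ) ≤ diffCount A x := Nat.cast_nonneg _
  refine ⟨D x, Finset.filter_subset _ _, ?_, ?_⟩
  · change c / 4 * a < (diffCount A x : ℝ)
    by_contra! h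
    nlinarith [mul_le_mul_of_nonneg_right h hr0]
  · change 16 * bad x ≤ (diffCount A x : ℝ) ^ 2
    have : 0 ≤ c / 4 * a * diffCount A x := by positivity
    linarith

/-- The **Balog–Szemerédi–Gowers theorem**, for difference sets. -/
theorem balog_szemeredi_gowers (A : Finset G) (hA : A.Nonempty) {c : ℝ} (hc : 0 < c)
    (hE : c * (A.card : ℝ) ^ 3 ≤ ∑ d, (diffCount A d : ℝ) ^ 2) :
    ∃ B ⊆ A, c / 8 * A.card ≤ B.card ∧ ((B - B).card : ℝ) ≤ 8192 / c ^ 3 * A.card := by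
  obtain ⟨D, hDA, hD, hbad⟩ := exists_translate_popular A hA hc hE
  set a : ℝ := (A.card : ℝ) with ha
  have ha0 : 0 < a := by simpa [ha] using hA
  set r : ℝ := (D.card : ℝ) with hr
  have hr0 : 0 < r := lt_of_le_of_lt (by positivity) hD
  let bad : G → Finset G := fun p => D.filter fun q => (diffCount A (p - q) : ℝ) < c / 32 * a
  let B := D.filter fun p => ((bad p).card : ℝ) ≤ r / 4
  have hsum : ∑ p ∈ D, ((bad p).card : ℝ) =
      (((D ×ˢ D).filter fun z => (diffCount A (z.1 - z.2) : ℝ) < c / 32 * a).card : ℝ) := by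
    simp_rw [bad, Finset.card_filter]
    rw [Finset.sum_product]
    push_cast
    rfl
  have hBc : ((D \ B).card : ℝ) ≤ r / 4 := by
    have h1 : ((D \ B).card : ℝ) * (r / 4) ≤ ∑ p ∈ D, ((bad p).card : ℝ) := by
      calc ((D \ B).card : ℝ) * (r / 4) = ∑ p ∈ D \ B, r / 4 := by simp
        _ ≤ ∑ p ∈ D \ B, ((bad p).card : ℝ) := by
          refine Finset.sum_le_sum fun p hp => ?_
          simp only [B, Finset.mem_sdiff, Finset.mem_filter, not_and, not_le] at hp
          exact (hp.2 hp.1).le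
        _ ≤ _ := Finset.sum_le_sum_of_subset_of_nonneg Finset.sdiff_subset
          fun _ _ _ => Nat.cast_nonneg _
    nlinarith
  have hB : r / 2 ≤ B.card := by
    have h2 : ((D \ B).card : ℝ) + B.card = r := by
      rw [hr]
      exact_mod_cast Finset.card_sdiff_add_card_eq_card (Finset.filter_subset _ D)
    linarith
  refine ⟨B, (Finset.filter_subset _ _).trans hDA, by linarith, ?_⟩
  -- `T d` counts the quadruples in `A` with `(a₁ - a₂) - (a₃ - a₄) = d`. There are `a ^ 4`
  -- quadruples in all, so few `d` can have a large `T d`.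
  let T : G → ℝ := fun d => ∑ e, (diffCount A e : ℝ) * diffCount A (e - d)
  have hT0 (d : G) : 0 ≤ T d := Finset.sum_nonneg fun _ _ => by positivity
  have hT : ∑ d, T d = a ^ 4 := by
    simp_rw [T]
    rw [Finset.sum_comm]
    simp_rw [← Finset.mul_sum]
    have h (e : G) : ∑ d, (diffCount A (e - d) : ℝ) = a ^ 2 := by
      rw [Fintype.sum_equiv (Equiv.subLeft e) (fun d => (diffCount A (e - d) : ℝ))
        (fun d => (diffCount A d : ℝ)) fun _ => rfl,
        sum_diffCount]
    simp_rw [h, ← Finset.sum_mul, sum_diffCount]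
    ring
  have hTd : ∀ d ∈ B - B, r / 2 * (c / 32 * a) ^ 2 ≤ T d := by
    intro d hd
    obtain ⟨p, hp, p', hp', rfl⟩ := Finset.mem_sub.1 hd
    -- Each `q` in `Q` writes `p - p'` as a difference of two popular differences, `p - q` and `p' -
    -- q`.
    let Q := D \ (bad p ∪ bad p')
    have hQ : r / 2 ≤ Q.card := by
      have h1 := Finset.le_card_sdiff (bad p ∪ bad p') D
      have h2 := Finset.card_union_le (bad p) (bad p')
      have h3 : (D.card : ℝ) ≤ Q.card + ((bad p).card + (bad p').card) := by
        have : D.card ≤ Q.card + ((bad p).card + (bad p').card) := by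
          simp only [Q]
          omega
        exact_mod_cast this
      have h4 := (Finset.mem_filter.1 hp).2
      have h5 := (Finset.mem_filter.1 hp').2
      linarith
    calc r / 2 * (c / 32 * a) ^ 2 ≤ ∑ q ∈ Q, (c / 32 * a) ^ 2 := by
          rw [Finset.sum_const, nsmul_eq_mul]
          gcongr
      _ ≤ ∑ q ∈ Q, (diffCount A (p - q) : ℝ) * diffCount A (p' - q) := by
          refine Finset.sum_le_sum fun q hq => ?_
          simp only [Q, bad, Finset.mem_sdiff, Finset.mem_union, Finset.mem_filter, not_or,
            not_and, not_lt] at hq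
          rw [sq]
          exact mul_le_mul (hq.2.1 hq.1) (hq.2.2 hq.1) (by positivity) (by positivity)
      _ = ∑ e ∈ Q.image (fun q => p - q), (diffCount A e : ℝ) * diffCount A (e - (p - p')) := by
          rw [Finset.sum_image fun x _ y _ h => sub_right_injective h]
          refine Finset.sum_congr rfl fun q _ => ?_
          rw [show p' - q = p - q - (p - p') by abel]
      _ ≤ _ := Finset.sum_le_sum_of_subset_of_nonneg (Finset.subset_univ _)
          fun _ _ _ => by positivity
  have hmain : ((B - B).card : ℝ) * (r / 2 * (c / 32 * a) ^ 2) ≤ a ^ 4 := by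
    rw [← hT, ← nsmul_eq_mul, ← Finset.sum_const]
    exact (Finset.sum_le_sum hTd).trans
      (Finset.sum_le_sum_of_subset_of_nonneg (Finset.subset_univ _) fun _ _ _ => hT0 _)
  have h6 : ((B - B).card : ℝ) * (c / 4 * a / 2 * (c / 32 * a) ^ 2) ≤ a ^ 4 :=
    le_trans (by gcongr) hmain
  have h7 : a ^ 4 = 8192 / c ^ 3 * a * (c / 4 * a / 2 * (c / 32 * a) ^ 2) := by
    field_simp
    norm_num
  rw [h7] at h6
  exact le_of_mul_le_mul_right h6 (by positivity)

end BalogSzemerediGowers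

/-! ### Freiman's theorem in bounded torsion. -/

section Freiman

/-- **Freiman's theorem** in a vector space over `𝔽₅`: a set of small doubling spans a small
subspace. -/
theorem card_span_le_of_card_sub_le {V : Type*} [AddCommGroup V] [Module (ZMod 5) V] [Finite V]
    [DecidableEq V] (B : Finset V) (hB : B.Nonempty) {K : ℝ}
    (hK : ((B - B).card : ℝ) ≤ K * B.card) :
    (Nat.card (Submodule.span (ZMod 5) (B : Set V)) : ℝ) ≤ 5 ^ (K ^ 4) * (K * B.card) := by
  have hb0 : (0 : ℝ) < B.card := by simpa using hB
  have hPR : (((B + (B - B)) + B).card : ℝ) ≤ K ^ 4 * B.card := by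
    have h := Finset.pluennecke_ruzsa_inequality_nsmul_sub_nsmul_sub hB B 3 1
    have h' : (((3 • B - 1 • B).card : ℚ≥0) : ℝ) ≤
        (((((B - B).card : ℚ≥0) / B.card) ^ (3 + 1) * B.card : ℚ≥0) : ℝ) := by exact_mod_cast h
    push_cast at h'
    have e : (B + (B - B)) + B = 3 • B - 1 • B := by
      rw [one_nsmul, succ_nsmul, two_nsmul, sub_eq_add_neg, sub_eq_add_neg, ← add_assoc,
        add_right_comm]
    rw [e]
    refine h'.trans ?_
    gcongr
    rwa [div_le_iff₀ hb0]
  obtain ⟨F, -, hFK, hF⟩ := Finset.ruzsa_covering_add hB hPR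
  let S := Submodule.span (ZMod 5) (F : Set V)
  -- Covering gives `B + (B - B) ⊆ F + (B - B)`. Adding an element of `B` to `T` thus only produces
  -- an element of `F`, which `S` absorbs.
  let T : Set V := (S : Set V) + ((B - B : Finset V) : Set V)
  have hT : ∀ t ∈ T, ∀ b ∈ B, b + t ∈ T := by
    rintro _ ⟨s, hs, d, hd, rfl⟩ b hb
    obtain ⟨f, hf, d', hd', h⟩ := Finset.mem_add.1 (hF (Finset.add_mem_add hb hd))
    refine ⟨f + s, S.add_mem (Submodule.subset_span hf) hs, d', hd', ?_⟩
    simp only at h ⊢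
    rw [add_right_comm, h]
    abel
  have hspan : (Submodule.span (ZMod 5) (B : Set V) : Set V) ⊆ T := by
    have key : ∀ x ∈ Submodule.span (ZMod 5) (B : Set V), ∀ t ∈ T, x + t ∈ T := by
      intro x hx
      induction hx using Submodule.span_induction with
      | mem x hx => exact fun t ht => hT t ht x hx
      | zero => simp
      | add x y _ _ hx hy =>
        intro t ht
        rw [add_assoc]
        exact hx _ (hy t ht)
      | smul c x _ hx =>
        -- Scalars of 𝔽₅ act as natural multiples, so stability under addition suffices.
        have h (m : ℕ) : ∀ t ∈ T, m • x + t ∈ T := by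
          induction m with
          | zero => simp
          | succ m ih =>
            intro t ht
            rw [succ_nsmul, add_assoc]
            exact ih _ (hx t ht)
        have hc : c • x = c.val • x := by
          rw [← Nat.cast_smul_eq_nsmul (ZMod 5), ZMod.natCast_zmod_val]
        rw [hc]
        exact h _
    obtain ⟨b, hb⟩ := hB
    have h0 : (0 : V) ∈ T := ⟨0, S.zero_mem, 0,
      Finset.mem_coe.2 (Finset.mem_sub.2 ⟨b, hb, b, hb, sub_self b⟩), by simp⟩
    intro x hx
    simpa using key x hx 0 h0
  have hS : (Nat.card S : ℝ) ≤ 5 ^ (K ^ 4) := by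
    have : Fact (Nat.Prime 5) := ⟨by norm_num⟩
    have h1 : Nat.card S ≤ 5 ^ F.card := by
      rw [Module.natCard_eq_pow_finrank (K := ZMod 5), Nat.card_zmod]
      exact Nat.pow_le_pow_right (by norm_num) (finrank_span_finset_le_card F)
    calc (Nat.card S : ℝ) ≤ (5 : ℝ) ^ (F.card : ℝ) := by
          rw [Real.rpow_natCast]
          exact_mod_cast h1
      _ ≤ 5 ^ (K ^ 4) := Real.rpow_le_rpow_of_exponent_le (by norm_num) hFK
  have hcard : Nat.card (Submodule.span (ZMod 5) (B : Set V)) ≤ Nat.card S * (B - B).card := by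
    calc _ ≤ Nat.card T := Nat.card_mono (Set.toFinite _) hspan
      _ ≤ Nat.card (S : Set V) * Nat.card ((B - B : Finset V) : Set V) := Set.natCard_add_le
      _ = _ := by rw [Nat.card_coe_set_eq ((B - B : Finset V) : Set V), Set.ncard_coe_finset]; rfl
  calc (Nat.card (Submodule.span (ZMod 5) (B : Set V)) : ℝ)
      ≤ Nat.card S * (B - B).card := by exact_mod_cast hcard
    _ ≤ _ := by gcongr

end Freiman

/-! ### From a small span to an affine map. -/

section Linearization

variable {ι : Type*} [Fintype ι] [DecidableEq ι]

/-- If many points of the graph of `φ` span a small subspace, then `φ` agrees with an affine map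
at many points. -/
lemma exists_affine_of_span_small (φ : (ι → ZMod 5) → ι → ZMod 5) (H : Finset (ι → ZMod 5))
    (B : Finset (ι ⊕ ι → ZMod 5)) (hB : ∀ z ∈ B, ∃ h ∈ H, z = Sum.elim h (φ h)) :
    ∃ (M : Matrix ι ι (ZMod 5)) (b : ι → ZMod 5),
      B.card ^ 2 ≤ Nat.card (Submodule.span (ZMod 5) (B : Set (ι ⊕ ι → ZMod 5))) *
        (H.filter fun h => φ h = M *ᵥ h + b).card := by
  have : Fact (Nat.Prime 5) := ⟨by norm_num⟩
  set S := Submodule.span (ZMod 5) (B : Set (ι ⊕ ι → ZMod 5)) with hS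
  let π₁ : (ι ⊕ ι → ZMod 5) →ₗ[ZMod 5] (ι → ZMod 5) := LinearMap.funLeft _ _ Sum.inl
  let π₂ : (ι ⊕ ι → ZMod 5) →ₗ[ZMod 5] (ι → ZMod 5) := LinearMap.funLeft _ _ Sum.inr
  let p : S →ₗ[ZMod 5] (ι → ZMod 5) := π₁.domRestrict S
  obtain ⟨σ, hσ⟩ := p.rangeRestrict.exists_rightInverse_of_surjective p.range_rangeRestrict
  obtain ⟨L, hL⟩ := LinearMap.exists_extend ((π₂.domRestrict S).comp σ)
  have hLp (s : S) : L (p s) = π₂ (σ (p.rangeRestrict s)) :=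
    LinearMap.congr_fun hL (p.rangeRestrict s)
  have hpσ (s : S) : p (σ (p.rangeRestrict s)) = p s :=
    congrArg Subtype.val (LinearMap.congr_fun hσ (p.rangeRestrict s))
  -- `L` extends a linear section of the projection of `S` to the first coordinates. On `B`, `κ`
  -- measures the deviation from `L`; it lies in the image of `ker p`, so it takes at most `|ker p|`
  -- values, and `b` is the most frequent one.
  let κ : (ι ⊕ ι → ZMod 5) → ι → ZMod 5 := fun z => π₂ z - L (π₁ z)
  obtain ⟨b, hb⟩ := Finite.exists_max fun b => (B.filter fun z => κ z = b).card
  have hinj : Set.InjOn π₁ (B : Set (ι ⊕ ι → ZMod 5)) := by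
    intro z hz z' hz' h
    obtain ⟨x, -, rfl⟩ := hB z hz
    obtain ⟨y, -, rfl⟩ := hB z' hz'
    have : x = y := h
    rw [this]
  have h1 : B.card ≤ (B.filter fun z => κ z = b).card * (B.image κ).card :=
    Finset.card_le_mul_card_image _ _ fun a _ => hb a
  have h2 : (B.image κ).card ≤ Nat.card (LinearMap.ker p) := by
    rw [← Fintype.card_coe, ← Nat.card_eq_fintype_card]
    have hmem : ∀ v : B.image κ, ∃ s : LinearMap.ker p, π₂ s.1.1 = v.1 := by
      rintro ⟨v, hv⟩
      obtain ⟨z, hz, rfl⟩ := Finset.mem_image.1 hv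
      let s : S := ⟨z, Submodule.subset_span hz⟩
      refine ⟨⟨s - σ (p.rangeRestrict s), ?_⟩, ?_⟩
      · rw [LinearMap.mem_ker, map_sub, hpσ, sub_self]
      · change π₂ (z - (σ (p.rangeRestrict s)).1) = π₂ z - L (p s)
        rw [map_sub, hLp]
    choose g hg using hmem
    refine Nat.card_le_card_of_injective g fun v w h => Subtype.ext ?_
    rw [← hg v, ← hg w, h]
  have h3 : B.card ≤ Nat.card (LinearMap.range p) := by
    rw [← Finset.card_image_of_injOn hinj, ← Fintype.card_coe, ← Nat.card_eq_fintype_card]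
    refine Nat.card_mono (Set.toFinite _) ?_
    intro v hv
    obtain ⟨z, hz, rfl⟩ := Finset.mem_image.1 hv
    exact ⟨⟨z, Submodule.subset_span hz⟩, rfl⟩
  have h4 : Nat.card (LinearMap.range p) * Nat.card (LinearMap.ker p) = Nat.card S := by
    rw [Module.natCard_eq_pow_finrank (K := ZMod 5) (V := LinearMap.range p),
      Module.natCard_eq_pow_finrank (K := ZMod 5) (V := LinearMap.ker p),
      Module.natCard_eq_pow_finrank (K := ZMod 5) (V := S), ← pow_add,
      LinearMap.finrank_range_add_finrank_ker]
  refine ⟨LinearMap.toMatrix' L, b, ?_⟩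
  have h5 : (B.filter fun z => κ z = b).card ≤
      (H.filter fun h => φ h = LinearMap.toMatrix' L *ᵥ h + b).card := by
    refine Finset.card_le_card_of_injOn π₁ ?_
      (hinj.mono fun z hz => Finset.filter_subset _ _ hz)
    intro z hz
    obtain ⟨hzB, hz⟩ := Finset.mem_filter.1 hz
    obtain ⟨x, hx, rfl⟩ := hB z hzB
    refine Finset.mem_filter.2 ⟨hx, ?_⟩
    rw [LinearMap.toMatrix'_mulVec, ← hz]
    change φ x = L x + (φ x - L x)
    abel
  calc B.card ^ 2 = B.card * B.card := sq _
    _ ≤ Nat.card (LinearMap.range p) *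
        ((H.filter fun h => φ h = LinearMap.toMatrix' L *ᵥ h + b).card *
          Nat.card (LinearMap.ker p)) :=
        Nat.mul_le_mul h3 (h1.trans (Nat.mul_le_mul h5 h2))
    _ = _ := by rw [← h4]; ring

end Linearization

/-! ### Multiplicative derivatives and additive energy. -/

section Derivative

variable {ι : Type*} [Fintype ι] [DecidableEq ι]

lemma conj_expect {α : Type*} [Fintype α] (f : α → ℂ) : conj (𝔼 x, f x) = 𝔼 x, conj (f x) := by
  simp [Fintype.expect_eq_sum_div_card]

lemma norm_expect_pow_le {α : Type*} [Fintype α] [Nonempty α] (f : α → ℂ) (n : ℕ) :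
    ‖𝔼 x, f x‖ ^ (n + 1) ≤ 𝔼 x, ‖f x‖ ^ (n + 1) := by
  have hN : (0 : ℝ) < Fintype.card α := by exact_mod_cast Fintype.card_pos
  have h1 : ‖𝔼 x, f x‖ ≤ 𝔼 x, ‖f x‖ := RCLike.norm_expect_le (K := ℂ)
  have h2 := pow_sum_div_card_le_sum_pow (s := Finset.univ) (f := fun x => ‖f x‖)
    (fun _ _ => norm_nonneg _) n
  refine (pow_le_pow_left₀ (norm_nonneg _) h1 _).trans ?_
  rw [Fintype.expect_eq_sum_div_card, Fintype.expect_eq_sum_div_card, div_pow, pow_succ _ n,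
    pow_succ (Fintype.card α : ℝ) n, ← pow_succ, ← div_div]
  gcongr
  simpa using h2

lemma norm_expect_mul_sq_le {α : Type*} [Fintype α] [Nonempty α] {p : α → ℂ}
    (hp : ∀ x, ‖p x‖ ≤ 1) (F : α → ℂ) : ‖𝔼 x, p x * F x‖ ^ 2 ≤ 𝔼 x, ‖F x‖ ^ 2 := by
  refine (norm_expect_pow_le _ 1).trans (Finset.expect_le_expect fun x _ => ?_)
  rw [norm_mul]
  exact pow_le_pow_left₀ (by positivity) (mul_le_of_le_one_left (norm_nonneg _) (hp x)) _

/-- The multiplicative derivative of `f` in direction `h`. -/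
noncomputable def mulDeriv (f : (ι → ZMod 5) → ℝ) (h x : ι → ZMod 5) : ℂ := f x * f (x + h)

lemma norm_coeff_le_one {g : (ι → ZMod 5) → ℂ} (hg : ∀ x, ‖g x‖ ≤ 1) (r : ι → ZMod 5) :
    ‖coeff g r‖ ≤ 1 := by
  refine (RCLike.norm_expect_le (K := ℂ)).trans
    (Finset.expect_le Finset.univ_nonempty fun x _ => ?_)
  rw [norm_mul, norm_phase, mul_one]
  exact hg x

variable {f : (ι → ZMod 5) → ℝ}

lemma norm_ofReal_le_one (hf : ∀ x, |f x| ≤ 1) (x : ι → ZMod 5) : ‖(f x : ℂ)‖ ≤ 1 := by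
  rw [Complex.norm_real]
  exact hf x

lemma norm_mulDeriv_le_one (hf : ∀ x, |f x| ≤ 1) (h x : ι → ZMod 5) : ‖mulDeriv f h x‖ ≤ 1 := by
  rw [mulDeriv, norm_mul]
  exact mul_le_one₀ (norm_ofReal_le_one hf x) (norm_nonneg _) (norm_ofReal_le_one hf _)

lemma norm_sq_coeff_mulDeriv (f : (ι → ZMod 5) → ℝ) (h s : ι → ZMod 5) :
    ((‖coeff (mulDeriv f h) s‖ ^ 2 : ℝ) : ℂ) =
      𝔼 x, 𝔼 k, f x * f (x + h) * f (x + k) * f (x + h + k) * phase s k := by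
  rw [Complex.ofReal_pow, ← Complex.conj_mul', coeff, conj_expect, Finset.expect_mul_expect]
  refine Finset.expect_congr rfl fun x _ => ?_
  refine (Fintype.expect_equiv (Equiv.addLeft x) _ _ fun k => ?_).symm
  simp only [Equiv.coe_addLeft, mulDeriv, map_mul, Complex.conj_ofReal, phase_add,
    add_right_comm x k h]
  have : conj (phase s x) * phase s x = 1 := by
    rw [Complex.conj_mul', norm_phase]
    norm_num
  linear_combination (-(f x * f (x + h) * f (x + k) * f (x + h + k) * phase s k : ℂ)) * this

/-- A large `U³`-norm forces most derivatives to have a large Fourier coefficient. -/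
lemma exists_deriv_coeff (hf : ∀ x, |f x| ≤ 1) :
    ∃ φ : (ι → ZMod 5) → ι → ZMod 5,
      cubeAverage f ^ 2 ≤ 𝔼 h, ‖coeff (mulDeriv f h) (φ h)‖ ^ 2 := by
  have hb := norm_mulDeriv_le_one hf
  -- For fixed `h`, the cube average becomes a box average of `mulDeriv f h`.
  choose φ hφ using fun h => exists_coeff_of_box (g₄ := mulDeriv f h) (hb h) (hb h) (hb h)
  refine ⟨φ, ?_⟩
  have hcube : (cubeAverage f : ℂ) = 𝔼 h, 𝔼 x, 𝔼 k, 𝔼 l,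
      mulDeriv f h x * mulDeriv f h (x + k) * mulDeriv f h (x + l) * mulDeriv f h (x + k + l) := by
    simp only [cubeAverage, Complex.ofReal_expect]
    refine Finset.expect_congr rfl fun h _ => ?_
    symm
    rw [Finset.expect_comm]
    refine Finset.expect_congr rfl fun k _ => ?_
    rw [Finset.expect_comm]
    refine Finset.expect_congr rfl fun l _ => Finset.expect_congr rfl fun x _ => ?_
    simp only [mulDeriv]
    push_cast
    rw [add_right_comm x k h, add_right_comm x l h, add_right_comm (x + k) l h,
      add_right_comm x k h]
    ring
  have h1 : cubeAverage f ≤ ‖(cubeAverage f : ℂ)‖ := by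
    rw [Complex.norm_real]
    exact le_abs_self _
  calc cubeAverage f ^ 2 ≤ ‖(cubeAverage f : ℂ)‖ ^ 2 :=
        pow_le_pow_left₀ (cubeAverage_nonneg f) h1 2
    _ ≤ _ := by
      rw [hcube]
      refine (norm_expect_pow_le _ 1).trans (Finset.expect_le_expect fun h _ => ?_)
      exact pow_le_pow_left₀ (norm_nonneg _) (hφ h) 2

lemma phase_sumElim (r k x y : ι → ZMod 5) :
    phase (Sum.elim r k) (Sum.elim x y) = phase r x * phase k y := by
  simp [phase, dotProduct, Fintype.sum_sum_type, AddChar.map_add_eq_mul]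

/-- The squared modulus of the exponential sum over `A` is the transform of `diffCount A`; Parseval
does the rest. -/
lemma sum_norm_pow_four (A : Finset (ι → ZMod 5)) :
    ∑ ξ, ‖∑ z ∈ A, phase ξ z‖ ^ 4 =
      Fintype.card (ι → ZMod 5) * ∑ d, (diffCount A d : ℝ) ^ 2 := by
  have hN : (0 : ℝ) < Fintype.card (ι → ZMod 5) := by exact_mod_cast Fintype.card_pos
  have h1 (ξ : ι → ZMod 5) : ((‖∑ z ∈ A, phase ξ z‖ ^ 2 : ℝ) : ℂ) =
      Fintype.card (ι → ZMod 5) * coeff (fun d => (diffCount A d : ℂ)) ξ := by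
    rw [coeff, Fintype.card_mul_expect, Complex.ofReal_pow, ← Complex.mul_conj', map_sum,
      Finset.sum_mul_sum]
    simp_rw [diffCount, Finset.card_filter, Nat.cast_sum, Finset.sum_mul]
    rw [Finset.sum_comm (s := Finset.univ)]
    refine Finset.sum_congr rfl fun a _ => ?_
    rw [Fintype.sum_equiv (Equiv.subLeft a)
      (fun d => (((if a - d ∈ A then 1 else 0 : ℕ) : ℂ)) * phase ξ d)
      (fun b => (((if b ∈ A then 1 else 0 : ℕ) : ℂ)) * phase ξ (a - b)) fun d => by simp]
    simp [phase_sub]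
  have h2 (ξ : ι → ZMod 5) : ‖∑ z ∈ A, phase ξ z‖ ^ 4 = (Fintype.card (ι → ZMod 5) : ℝ) ^ 2 *
      ‖coeff (fun d => (diffCount A d : ℂ)) ξ‖ ^ 2 := by
    have := congrArg (fun z => ‖z‖ ^ 2) (h1 ξ)
    simp only [Complex.norm_real, norm_mul, Complex.norm_natCast, norm_pow, norm_norm] at this
    rw [← mul_pow, ← this]
    ring
  simp_rw [h2]
  rw [← Finset.mul_sum, parseval, Fintype.expect_eq_sum_div_card]
  simp only [Complex.norm_natCast]
  field_simp

/-- The graph of `φ` over `H`. -/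
def graphOver (φ : (ι → ZMod 5) → ι → ZMod 5) (H : Finset (ι → ZMod 5)) :
    Finset (ι ⊕ ι → ZMod 5) := H.image fun h => Sum.elim h (φ h)

lemma sumElim_graph_injective (φ : (ι → ZMod 5) → ι → ZMod 5) :
    Function.Injective fun h => (Sum.elim h (φ h) : ι ⊕ ι → ZMod 5) := by
  intro x y h
  funext i
  exact congrFun h (Sum.inl i)

lemma card_graphOver (φ : (ι → ZMod 5) → ι → ZMod 5) (H : Finset (ι → ZMod 5)) :
    (graphOver φ H).card = H.card :=
  Finset.card_image_of_injective _ (sumElim_graph_injective φ)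

/-- If the derivatives of `f` in directions `h ∈ H` have large Fourier coefficients at `φ h`, then
the graph of `φ` over `H` has large additive energy. -/
lemma energy_graph (hf : ∀ x, |f x| ≤ 1) (φ : (ι → ZMod 5) → ι → ZMod 5)
    (H : Finset (ι → ZMod 5)) {c : ℝ} (hc : 0 ≤ c)
    (h : c ≤ 𝔼 h, if h ∈ H then ‖coeff (mulDeriv f h) (φ h)‖ ^ 2 else 0) :
    c ^ 4 * (Fintype.card (ι → ZMod 5) : ℝ) ^ 3 ≤
      ∑ d, (diffCount (graphOver φ H) d : ℝ) ^ 2 := by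
  set N : ℝ := (Fintype.card (ι → ZMod 5) : ℝ) with hN
  have hN0 : 0 < N := by
    rw [hN]
    exact_mod_cast Fintype.card_pos
  let u : (ι → ZMod 5) → (ι → ZMod 5) → ℂ := fun k h => if h ∈ H then phase (φ h) k else 0
  -- Expanding the squares and fixing `k` instead of `h` gives a trilinear form in which `φ` enters
  -- only through `u k`.
  let T : (ι → ZMod 5) → ℂ := fun k =>
    𝔼 x, 𝔼 h, (f x * f (x + k) : ℂ) * (f (x + h) * f (x + h + k) : ℂ) * u k h
  have h1 : ((𝔼 h, if h ∈ H then ‖coeff (mulDeriv f h) (φ h)‖ ^ 2 else 0 : ℝ) : ℂ) =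
      𝔼 k, T k := by
    rw [Complex.ofReal_expect]
    calc _ = 𝔼 h, 𝔼 x, 𝔼 k, (f x * f (x + k) : ℂ) * (f (x + h) * f (x + h + k) : ℂ) * u k h := by
          refine Finset.expect_congr rfl fun h _ => ?_
          by_cases hh : h ∈ H
          · simp only [if_pos hh, norm_sq_coeff_mulDeriv, u]
            refine Finset.expect_congr rfl fun x _ => Finset.expect_congr rfl fun k _ => by ring
          · simp [hh, u]
      _ = 𝔼 h, 𝔼 k, 𝔼 x, (f x * f (x + k) : ℂ) * (f (x + h) * f (x + h + k) : ℂ) * u k h :=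
          Finset.expect_congr rfl fun h _ => Finset.expect_comm _ _ _
      _ = 𝔼 k, 𝔼 h, 𝔼 x, (f x * f (x + k) : ℂ) * (f (x + h) * f (x + h + k) : ℂ) * u k h :=
          Finset.expect_comm _ _ _
      _ = _ := Finset.expect_congr rfl fun h _ => Finset.expect_comm _ _ _
  -- The maximum over `r` is replaced by a sum of fourth powers, so that summing over `k` as well
  -- yields a full fourth moment on the space containing the graph.
  have h2 (k : ι → ZMod 5) : ‖T k‖ ^ 4 ≤ ∑ r, ‖coeff (u k) r‖ ^ 4 := by
    obtain ⟨r, hr⟩ := Finite.exists_max fun r => ‖coeff (u k) r‖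
    have hk (x : ι → ZMod 5) : ‖(f x * f (x + k) : ℂ)‖ ≤ 1 := norm_mulDeriv_le_one hf k x
    have := norm_trilinear_le' (c := fun y => (f y * f (y + k) : ℂ)) hk hk hr
    exact (pow_le_pow_left₀ (norm_nonneg _) this 4).trans
      (Finset.single_le_sum (f := fun r => ‖coeff (u k) r‖ ^ 4)
        (fun _ _ => by positivity) (Finset.mem_univ r))
  -- The coefficient of `u k` at `r` is the normalised transform of the graph at `(r, k)`.
  have h3 (k r : ι → ZMod 5) : ‖coeff (u k) r‖ ^ 4 =
      ‖∑ z ∈ graphOver φ H, phase (Sum.elim r k) z‖ ^ 4 / N ^ 4 := by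
    rw [← div_pow, coeff, Fintype.expect_eq_sum_div_card, norm_div, Complex.norm_natCast]
    congr 3
    rw [graphOver, Finset.sum_image fun x _ y _ h => sumElim_graph_injective φ h]
    simp only [u, phase_sumElim, ite_mul, zero_mul, phase_comm k]
    rw [Finset.sum_ite_mem, Finset.univ_inter]
    exact Finset.sum_congr rfl fun x _ => mul_comm _ _
  have hcard : (Fintype.card (ι ⊕ ι → ZMod 5) : ℝ) = N ^ 2 := by
    rw [hN]
    simp only [Fintype.card_pi, Finset.prod_const, Finset.card_univ, Fintype.card_sum]
    push_cast
    ring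
  have h4 : c ^ 4 ≤ (∑ k, ∑ r,
      ‖∑ z ∈ graphOver φ H, phase (Sum.elim r k) z‖ ^ 4 / N ^ 4) / N := by
    calc c ^ 4 ≤ ‖𝔼 k, T k‖ ^ 4 := by
          refine pow_le_pow_left₀ hc (h.trans ?_) 4
          rw [← h1, Complex.norm_real]
          exact le_abs_self _
      _ ≤ 𝔼 k, ‖T k‖ ^ 4 := norm_expect_pow_le _ 3
      _ ≤ 𝔼 k, ∑ r, ‖coeff (u k) r‖ ^ 4 := Finset.expect_le_expect fun k _ => h2 k
      _ = _ := by
        rw [Fintype.expect_eq_sum_div_card]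
        simp_rw [h3]
        rfl
  have h5 : ∑ k, ∑ r, ‖∑ z ∈ graphOver φ H, phase (Sum.elim r k) z‖ ^ 4 =
      N ^ 2 * ∑ d, (diffCount (graphOver φ H) d : ℝ) ^ 2 := by
    rw [← hcard, ← sum_norm_pow_four, Finset.sum_comm, ← Fintype.sum_prod_type']
    exact Fintype.sum_equiv (Equiv.sumArrowEquivProdArrow ι ι (ZMod 5)).symm _ _ fun _ => rfl
  simp_rw [← Finset.sum_div] at h4
  rw [h5, div_div, le_div_iff₀ (by positivity)] at h4
  have : N ^ 2 * (c ^ 4 * N ^ 3) ≤ N ^ 2 * ∑ d, (diffCount (graphOver φ H) d : ℝ) ^ 2 := by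
    linarith [show N ^ 2 * (c ^ 4 * N ^ 3) = c ^ 4 * (N ^ 4 * N) by ring]
  exact le_of_mul_le_mul_left this (by positivity)

end Derivative

/-! ### Symmetry of the linear map. -/

section Symmetry

variable {ι : Type*} [Fintype ι] [DecidableEq ι]

/-- The range of a square matrix, as a finite set. -/
def matrixRange (D : Matrix ι ι (ZMod 5)) : Finset (ι → ZMod 5) :=
  Finset.univ.image fun k => D *ᵥ k

/-- For uniform `k`, `D *ᵥ k` is uniform on the range: its distribution is invariant under shifts by
the range. -/
lemma card_matrixRange_mul_expect_le (D : Matrix ι ι (ZMod 5)) {g : (ι → ZMod 5) → ℝ}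
    (hg : ∀ x, 0 ≤ g x) : (matrixRange D).card * 𝔼 k, g (D *ᵥ k) ≤ ∑ v, g v := by
  have h1 : ∀ v ∈ matrixRange D, 𝔼 k, g (D *ᵥ k) = 𝔼 k, g (D *ᵥ k + v) := by
    intro v hv
    obtain ⟨l, -, rfl⟩ := Finset.mem_image.1 hv
    simp_rw [← Matrix.mulVec_add]
    exact (expect_comp_add_right (fun k => g (D *ᵥ k)) l).symm
  rw [← nsmul_eq_mul, ← Finset.sum_const, Finset.sum_congr rfl h1, ← Finset.expect_sum_comm]
  refine Finset.expect_le Finset.univ_nonempty fun k _ => ?_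
  calc _ ≤ ∑ v, g (D *ᵥ k + v) := Finset.sum_le_sum_of_subset_of_nonneg (Finset.subset_univ _)
        fun _ _ _ => hg _
    _ = ∑ v, g v := Fintype.sum_equiv (Equiv.addLeft (D *ᵥ k)) _ _ fun _ => rfl

lemma phase_mulVec (M : Matrix ι ι (ZMod 5)) (x y : ι → ZMod 5) :
    phase (M *ᵥ x) y = phase (Mᵀ *ᵥ y) x := by
  rw [phase, phase, Matrix.mulVec_transpose, ← Matrix.dotProduct_mulVec, dotProduct_comm]

lemma phase_neg (r x : ι → ZMod 5) : phase r (-x) = (phase r x)⁻¹ := by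
  have h : phase r (-x) * phase r x = 1 := by rw [← phase_add, neg_add_cancel, phase_zero]
  exact eq_inv_of_mul_eq_one_left h

lemma phase_ne_zero (r x : ι → ZMod 5) : phase r x ≠ 0 := by
  rw [← norm_ne_zero_iff, norm_phase]
  exact one_ne_zero

/-- If a bilinear phase correlates with a product of functions of `h`, `k` and `h + k`, then its
antisymmetric part has small rank. -/
lemma card_range_le_of_correlation (M : Matrix ι ι (ZMod 5)) {p q w : (ι → ZMod 5) → ℂ}
    (hp : ∀ x, ‖p x‖ ≤ 1) (hq : ∀ x, ‖q x‖ ≤ 1) (hw : ∀ x, ‖w x‖ ≤ 1) {c : ℝ} (hc : 0 ≤ c)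
    (h : c ≤ ‖𝔼 h, p h * 𝔼 k, q k * w (h + k) * phase (M *ᵥ h) k‖) :
    c ^ 4 * (matrixRange (Mᵀ - M)).card ≤ 1 := by
  let α : (ι → ZMod 5) → (ι → ZMod 5) → ℂ := fun t k =>
    conj (q k) * w (t - k) * phase (M *ᵥ t) (-k) * phase (M *ᵥ k) k
  let β : (ι → ZMod 5) → (ι → ZMod 5) → ℂ := fun t k =>
    q k * conj (w (t - k)) * phase (M *ᵥ t) k * phase (M *ᵥ k) (-k)
  have hα (t k : ι → ZMod 5) : ‖α t k‖ ≤ 1 := by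
    simp only [α, norm_mul, norm_phase, mul_one, RCLike.norm_conj]
    exact mul_le_one₀ (hq _) (norm_nonneg _) (hw _)
  have hβ (t k : ι → ZMod 5) : ‖β t k‖ ≤ 1 := by
    simp only [β, norm_mul, norm_phase, mul_one, RCLike.norm_conj]
    exact mul_le_one₀ (hq _) (norm_nonneg _) (hw _)
  -- Square out with variables `k`, `l` and substitute `t = h + k + l`, so that `h + k = t - l` and
  -- `h + l = t - k`. With `t` fixed, the only factor coupling `k` and `l` is the phase of `((Mᵀ -
  -- M) k) ⬝ l`.
  have key : ((𝔼 h, ‖𝔼 k, q k * w (h + k) * phase (M *ᵥ h) k‖ ^ 2 : ℝ) : ℂ) =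
      𝔼 t, 𝔼 k, α t k * coeff (β t) ((Mᵀ - M) *ᵥ k) := by
    simp_rw [Complex.ofReal_expect, Complex.ofReal_pow, ← Complex.conj_mul', conj_expect,
      Finset.expect_mul_expect, coeff, Finset.mul_expect]
    rw [Finset.expect_comm]
    conv_rhs => rw [Finset.expect_comm]
    refine Finset.expect_congr rfl fun k _ => ?_
    rw [Finset.expect_comm]
    conv_rhs => rw [Finset.expect_comm]
    refine Finset.expect_congr rfl fun l _ => ?_
    refine Fintype.expect_equiv (Equiv.addRight (k + l)) _ _ fun x => ?_
    simp only [Equiv.coe_addRight, α, β]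
    rw [show x + (k + l) - k = x + l by abel, show x + (k + l) - l = x + k by abel]
    rw [Matrix.sub_mulVec]
    simp only [map_mul, conj_phase, phase_neg, Matrix.mulVec_add,
      phase_add_left, sub_eq_add_neg, phase_neg_left, phase_mulVec M l k]
    field_simp [phase_ne_zero]
  have h1 : c ^ 2 ≤ 𝔼 t, ‖𝔼 k, α t k * coeff (β t) ((Mᵀ - M) *ᵥ k)‖ := by
    calc c ^ 2 ≤ _ := pow_le_pow_left₀ hc h 2
      _ ≤ _ := norm_expect_mul_sq_le hp _
      _ ≤ ‖((𝔼 h, ‖𝔼 k, q k * w (h + k) * phase (M *ᵥ h) k‖ ^ 2 : ℝ) : ℂ)‖ := by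
        rw [Complex.norm_real]
        exact le_abs_self _
      _ ≤ _ := by
        rw [key]
        exact RCLike.norm_expect_le (K := ℂ)
  obtain ⟨t, -, ht⟩ := Finset.exists_le_of_le_expect Finset.univ_nonempty h1
  have h2 : c ^ 4 ≤ 𝔼 k, ‖coeff (β t) ((Mᵀ - M) *ᵥ k)‖ ^ 2 := by
    calc c ^ 4 = (c ^ 2) ^ 2 := by ring
      _ ≤ _ := pow_le_pow_left₀ (by positivity) ht 2
      _ ≤ _ := norm_expect_mul_sq_le (hα t) _
  have h3 := card_matrixRange_mul_expect_le (Mᵀ - M) (g := fun v => ‖coeff (β t) v‖ ^ 2)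
    fun _ => by positivity
  rw [parseval] at h3
  calc c ^ 4 * (matrixRange (Mᵀ - M)).card
      ≤ (𝔼 k, ‖coeff (β t) ((Mᵀ - M) *ᵥ k)‖ ^ 2) * (matrixRange (Mᵀ - M)).card := by gcongr
    _ ≤ 1 := by
      rw [mul_comm]
      exact h3.trans (expect_le_one_of_le_one (hβ t))

variable {f : (ι → ZMod 5) → ℝ}

lemma expect_coeff_affine (f : (ι → ZMod 5) → ℝ) (M : Matrix ι ι (ZMod 5)) (b : ι → ZMod 5) :
    ((𝔼 h, ‖coeff (mulDeriv f h) (M *ᵥ h + b)‖ ^ 2 : ℝ) : ℂ) =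
      𝔼 x, 𝔼 h, 𝔼 k, f x * f (x + h) * f (x + k) * f (x + h + k) * phase (M *ᵥ h + b) k := by
  rw [Complex.ofReal_expect]
  simp_rw [norm_sq_coeff_mulDeriv]
  rw [Finset.expect_comm]

/-- The linear map governing the derivatives of `f` is almost symmetric. -/
lemma card_range_antisymm_le (hf : ∀ x, |f x| ≤ 1) (M : Matrix ι ι (ZMod 5)) (b : ι → ZMod 5)
    {c : ℝ} (hc : 0 ≤ c) (h : c ≤ 𝔼 h, ‖coeff (mulDeriv f h) (M *ᵥ h + b)‖ ^ 2) :
    c ^ 4 * (matrixRange (Mᵀ - M)).card ≤ 1 := by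
  have hb := norm_ofReal_le_one hf
  let F : (ι → ZMod 5) → ℂ := fun x => 𝔼 h, (f x * f (x + h) : ℂ) *
    𝔼 k, (f (x + k) * phase b k : ℂ) * f (x + (h + k)) * phase (M *ᵥ h) k
  -- For a fixed base point `x`, the average over `h` and `k` has the shape required by
  -- `card_range_le_of_correlation`.
  have h1 : c ≤ 𝔼 x, ‖F x‖ := by
    refine h.trans ((le_abs_self _).trans ?_)
    rw [← Real.norm_eq_abs, ← Complex.norm_real, expect_coeff_affine]
    refine le_trans (le_of_eq ?_) (RCLike.norm_expect_le (K := ℂ))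
    congr 1
    refine Finset.expect_congr rfl fun x _ => Finset.expect_congr rfl fun h _ => ?_
    rw [Finset.mul_expect]
    refine Finset.expect_congr rfl fun k _ => ?_
    rw [phase_add_left, add_assoc]
    ring
  obtain ⟨x, -, hx⟩ := Finset.exists_le_of_le_expect Finset.univ_nonempty h1
  refine card_range_le_of_correlation M (p := fun h => (f x * f (x + h) : ℂ))
    (q := fun k => (f (x + k) * phase b k : ℂ)) (w := fun y => (f (x + y) : ℂ))
    (fun h => ?_) (fun k => ?_) (fun y => hb _) hc hx
  · rw [norm_mul]
    exact mul_le_one₀ (hb _) (norm_nonneg _) (hb _)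
  · rw [norm_mul, norm_phase, mul_one]
    exact hb _

/-- The linear map governing the derivatives of `f` may be taken to be symmetric. -/
lemma exists_symmetric (hf : ∀ x, |f x| ≤ 1) (M : Matrix ι ι (ZMod 5)) (b : ι → ZMod 5)
    {c : ℝ} (hc : 0 < c) (h : c ≤ 𝔼 h, ‖coeff (mulDeriv f h) (M *ᵥ h + b)‖ ^ 2) :
    ∃ (S : Matrix ι ι (ZMod 5)) (b' : ι → ZMod 5), Sᵀ = S ∧
      c ^ 5 ≤ 𝔼 h, ‖coeff (mulDeriv f h) (S *ᵥ h + b')‖ ^ 2 := by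
  have hR := card_range_antisymm_le hf M b hc.le h
  set R := matrixRange (Mᵀ - M) with hRdef
  -- As `3 = 1/2` in 𝔽₅, this is the symmetric part of `M`; the error `M - S = 2 (Mᵀ - M)` takes
  -- values in `R`.
  let S : Matrix ι ι (ZMod 5) := (3 : ZMod 5) • (M + Mᵀ)
  have hM (x : ι → ZMod 5) : M *ᵥ x + b = S *ᵥ x + (b + (Mᵀ - M) *ᵥ ((2 : ZMod 5) • x)) := by
    have : M = S + (2 : ZMod 5) • (Mᵀ - M) := by
      ext i j
      simp only [S, Matrix.add_apply, Matrix.smul_apply, Matrix.sub_apply, smul_eq_mul]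
      have h5 : (5 : ZMod 5) = 0 := rfl
      linear_combination (-(Mᵀ i j)) * h5
    conv_lhs => rw [this]
    rw [Matrix.add_mulVec, Matrix.mulVec_smul, Matrix.smul_mulVec _ (Mᵀ - M)]
    abel
  have h1 : c ≤ ∑ v ∈ R, 𝔼 h, ‖coeff (mulDeriv f h) (S *ᵥ h + (b + v))‖ ^ 2 := by
    rw [← Finset.expect_sum_comm]
    refine h.trans (Finset.expect_le_expect fun x _ => ?_)
    rw [hM]
    refine Finset.single_le_sum (f := fun v => ‖coeff (mulDeriv f x) (S *ᵥ x + (b + v))‖ ^ 2)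
      (fun _ _ => by positivity) ?_
    exact Finset.mem_image_of_mem _ (Finset.mem_univ _)
  have hne : R.Nonempty := Finset.univ_nonempty.image _
  -- Since `c ^ 4 * |R| ≤ 1`, the left side is at most `c`; some shift `v` carries at least `c ^ 5`.
  have h2 : ∑ v ∈ R, c ^ 5 ≤ ∑ v ∈ R, 𝔼 h, ‖coeff (mulDeriv f h) (S *ᵥ h + (b + v))‖ ^ 2 := by
    refine le_trans ?_ h1
    rw [Finset.sum_const, nsmul_eq_mul]
    nlinarith
  obtain ⟨v, -, hv⟩ := Finset.exists_le_of_sum_le hne h2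
  refine ⟨S, b + v, ?_, hv⟩
  rw [Matrix.transpose_smul, Matrix.transpose_add, Matrix.transpose_transpose, add_comm]

end Symmetry

/-! ### Integrating to a quadratic phase. -/

section Integration

variable {n : ℕ} {f : (Fin n → ZMod 5) → ℝ}

lemma norm_quadraticPhase (M : Matrix (Fin n) (Fin n) (ZMod 5)) (r x : Fin n → ZMod 5) :
    ‖quadraticPhase M r x‖ = 1 := by
  simp [quadraticPhase]

lemma quadraticPhase_add (M : Matrix (Fin n) (Fin n) (ZMod 5)) (r s x : Fin n → ZMod 5) :
    quadraticPhase M (r + s) x = quadraticPhase M r x * phase s x := by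
  simp only [quadraticPhase, phase, add_dotProduct, ← AddChar.map_add_eq_mul, add_assoc]

/-- A symmetric bilinear phase is a second derivative of a quadratic phase. -/
lemma phase_eq_quadraticPhase {S : Matrix (Fin n) (Fin n) (ZMod 5)} (hS : Sᵀ = S)
    (b x h k : Fin n → ZMod 5) :
    phase (S *ᵥ h + b) k =
      quadraticPhase ((3 : ZMod 5) • S) 0 x *
        conj (quadraticPhase ((3 : ZMod 5) • S) b (x + h)) *
        conj (quadraticPhase ((3 : ZMod 5) • S) 0 (x + k)) *
        quadraticPhase ((3 : ZMod 5) • S) b (x + h + k) := by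
  have hsymm (y z : Fin n → ZMod 5) : y ⬝ᵥ (S *ᵥ z) = z ⬝ᵥ (S *ᵥ y) := by
    conv_rhs => rw [Matrix.dotProduct_mulVec, ← Matrix.mulVec_transpose, hS, dotProduct_comm]
  -- The form `3 S` is `S / 2`, whose second difference is `h ⬝ S k`. Attaching `b` only to the
  -- points `x + h` and `x + h + k` leaves `b ⬝ k`.
  simp only [quadraticPhase, phase, ← AddChar.map_neg_eq_conj, ← AddChar.map_add_eq_mul]
  congr 1
  simp only [Matrix.smul_mulVec, Matrix.mulVec_add, dotProduct_add, add_dotProduct,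
    dotProduct_smul, smul_eq_mul, zero_dotProduct]
  rw [dotProduct_comm (S *ᵥ h) k, hsymm h x, hsymm k x, hsymm k h]
  have h5 : (5 : ZMod 5) = 0 := rfl
  linear_combination (-(h ⬝ᵥ (S *ᵥ k))) * h5

/-- Each quadratic phase is absorbed into the copy of `f` at the same point. This leaves a box
average, and a Fourier coefficient of `f` times a quadratic phase is again a quadratic correlation,
with `r` added to the linear part. -/
lemma exists_quadraticPhase (hf : ∀ x, |f x| ≤ 1) {S : Matrix (Fin n) (Fin n) (ZMod 5)}
    (hS : Sᵀ = S) (b : Fin n → ZMod 5) :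
    ∃ (M : Matrix (Fin n) (Fin n) (ZMod 5)) (r : Fin n → ZMod 5),
      𝔼 h, ‖coeff (mulDeriv f h) (S *ᵥ h + b)‖ ^ 2 ≤
        ‖𝔼 x : Fin n → ZMod 5, (f x : ℂ) * quadraticPhase M r x‖ := by
  have hb := norm_ofReal_le_one hf
  let Q := quadraticPhase ((3 : ZMod 5) • S)
  have hQ (g : (Fin n → ZMod 5) → ℂ) (hg : ∀ x, ‖g x‖ = 1) (x) : ‖(f x : ℂ) * g x‖ ≤ 1 := by
    rw [norm_mul, hg, mul_one]
    exact hb x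
  have hQ1 (r x : Fin n → ZMod 5) : ‖Q r x‖ = 1 := norm_quadraticPhase _ _ _
  obtain ⟨r, hr⟩ := exists_coeff_of_box (g₄ := fun x => (f x : ℂ) * Q b x)
    (hQ (Q 0) (hQ1 0)) (hQ (fun x => conj (Q b x)) fun x => by rw [RCLike.norm_conj, hQ1])
    (hQ (fun x => conj (Q 0 x)) fun x => by rw [RCLike.norm_conj, hQ1])
  have hphase (x h k : Fin n → ZMod 5) :
      (f x * f (x + h) * f (x + k) * f (x + h + k) * phase (S *ᵥ h + b) k : ℂ) =
        (f x * Q 0 x) * (f (x + h) * conj (Q b (x + h))) * (f (x + k) * conj (Q 0 (x + k))) *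
          (f (x + h + k) * Q b (x + h + k)) := by
    rw [phase_eq_quadraticPhase hS b x]
    ring
  refine ⟨(3 : ZMod 5) • S, b + r, ?_⟩
  calc _ ≤ ‖((𝔼 h, ‖coeff (mulDeriv f h) (S *ᵥ h + b)‖ ^ 2 : ℝ) : ℂ)‖ := by
        rw [Complex.norm_real]
        exact le_abs_self _
    _ = ‖𝔼 x, 𝔼 h, 𝔼 k, (f x * Q 0 x : ℂ) * (f (x + h) * conj (Q b (x + h))) *
          (f (x + k) * conj (Q 0 (x + k))) * (f (x + h + k) * Q b (x + h + k))‖ := by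
        rw [expect_coeff_affine]
        simp_rw [hphase]
    _ ≤ _ := hr
    _ = _ := by simp_rw [coeff, Q, quadraticPhase_add, mul_assoc]

end Integration

/-! ### Assembly of the argument. -/

/-- The derivatives of a function of large `U³`-norm correlate with characters depending affinely
on the direction. -/
lemma exists_affine_deriv_coeff {c₀ : ℝ} (hc₀ : 0 < c₀) :
    ∃ c : ℝ, 0 < c ∧ ∀ (n : ℕ) (f : (Fin n → ZMod 5) → ℝ), (∀ x, |f x| ≤ 1) →
      ∀ φ : (Fin n → ZMod 5) → Fin n → ZMod 5,
        2 * c₀ ≤ 𝔼 h, ‖coeff (mulDeriv f h) (φ h)‖ ^ 2 →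
        ∃ (M : Matrix (Fin n) (Fin n) (ZMod 5)) (b : Fin n → ZMod 5),
          c ≤ 𝔼 h, ‖coeff (mulDeriv f h) (M *ᵥ h + b)‖ ^ 2 := by
  -- `K` is the doubling constant of the set `B` obtained from Balog–Szemerédi–Gowers with energy
  -- constant `c₀ ^ 4`; the factor `8 / c₀ ^ 4` compares `H` with `B`. `L` bounds the size of the
  -- span of `B` relative to `B`.
  set K : ℝ := 8192 / (c₀ ^ 4) ^ 3 * (8 / c₀ ^ 4) with hK
  have hK0 : 0 < K := by positivity
  set L : ℝ := 5 ^ (K ^ 4) * K with hL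
  have hL0 : 0 < L := by positivity
  refine ⟨c₀ ^ 4 / 8 * c₀ / L * c₀, by positivity, fun n f hf φ hφ => ?_⟩
  set N : ℝ := (Fintype.card (Fin n → ZMod 5) : ℝ) with hN
  have hN0 : 0 < N := by
    rw [hN]
    exact_mod_cast Fintype.card_pos
  let s : (Fin n → ZMod 5) → ℝ := fun h => ‖coeff (mulDeriv f h) (φ h)‖ ^ 2
  have hs1 (h) : s h ≤ 1 :=
    pow_le_one₀ (norm_nonneg _) (norm_coeff_le_one (norm_mulDeriv_le_one hf h) _)
  -- Discarding the directions below `c₀` costs at most `c₀` of the average `2 * c₀`.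
  let H : Finset (Fin n → ZMod 5) := Finset.univ.filter fun h => c₀ ≤ s h
  have hH : c₀ ≤ 𝔼 h, if h ∈ H then s h else 0 := by
    have h1 : 𝔼 h, s h ≤ 𝔼 h, ((if h ∈ H then s h else 0) + c₀) := by
      refine Finset.expect_le_expect fun h _ => ?_
      split_ifs with hh
      · linarith
      · simp only [H, Finset.mem_filter, Finset.mem_univ, true_and, not_le] at hh
        linarith
    rw [Finset.expect_add_distrib, Finset.expect_const Finset.univ_nonempty] at h1
    linarith
  have hHcard : c₀ * N ≤ H.card := by
    have h1 : 𝔼 h, (if h ∈ H then s h else 0) ≤ 𝔼 h, if h ∈ H then (1 : ℝ) else 0 := by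
      refine Finset.expect_le_expect fun h _ => ?_
      split_ifs
      · exact hs1 h
      · exact le_rfl
    rw [Fintype.expect_eq_sum_div_card (fun h => if h ∈ H then (1 : ℝ) else 0)] at h1
    rw [← le_div_iff₀ hN0]
    refine hH.trans (h1.trans (le_of_eq ?_))
    simp [hN]
  have hA : (graphOver φ H).Nonempty := by
    rw [← Finset.card_pos, card_graphOver]
    have : (0 : ℝ) < H.card := lt_of_lt_of_le (by positivity) hHcard
    exact_mod_cast this
  have hHN : (H.card : ℝ) ≤ N := by
    rw [hN]
    exact_mod_cast Finset.card_le_univ H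
  have hE : c₀ ^ 4 * ((graphOver φ H).card : ℝ) ^ 3 ≤
      ∑ d, (diffCount (graphOver φ H) d : ℝ) ^ 2 := by
    refine le_trans ?_ (energy_graph hf φ H hc₀.le hH)
    rw [card_graphOver]
    gcongr
  obtain ⟨B, hBA, hBcard, hBB⟩ := balog_szemeredi_gowers _ hA (by positivity) hE
  rw [card_graphOver] at hBcard hBB
  have hB0 : (0 : ℝ) < B.card := lt_of_lt_of_le
    (mul_pos (by positivity) (lt_of_lt_of_le (by positivity) hHcard)) hBcard
  have hdoubling : ((B - B).card : ℝ) ≤ K * B.card := by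
    refine hBB.trans ?_
    rw [hK, mul_assoc]
    gcongr
    rw [div_mul_eq_mul_div, le_div_iff₀ (by positivity)]
    linarith
  have hspan := card_span_le_of_card_sub_le B (Finset.card_pos.1 (by exact_mod_cast hB0)) hdoubling
  obtain ⟨M, b, hMb⟩ := exists_affine_of_span_small φ H B fun z hz => by
    obtain ⟨h, hh, rfl⟩ := Finset.mem_image.1 (hBA hz)
    exact ⟨h, hh, rfl⟩
  refine ⟨M, b, ?_⟩
  set H' := H.filter fun h => φ h = M *ᵥ h + b with hH'
  have h1 : (B.card : ℝ) ≤ L * H'.card := by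
    have h2 : (B.card : ℝ) ^ 2 ≤
        Nat.card (Submodule.span (ZMod 5) (B : Set (Fin n ⊕ Fin n → ZMod 5))) * H'.card := by
      exact_mod_cast hMb
    have h3 : (B.card : ℝ) * B.card ≤ (L * H'.card) * B.card := by
      calc (B.card : ℝ) * B.card = (B.card : ℝ) ^ 2 := (sq _).symm
        _ ≤ _ := h2
        _ ≤ (5 ^ (K ^ 4) * (K * B.card)) * H'.card := by gcongr
        _ = _ := by rw [hL]; ring
    exact le_of_mul_le_mul_right h3 hB0
  have h4 : c₀ ^ 4 / 8 * c₀ / L * N ≤ H'.card := by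
    rw [div_mul_eq_mul_div, div_le_iff₀ hL0]
    calc c₀ ^ 4 / 8 * c₀ * N = c₀ ^ 4 / 8 * (c₀ * N) := by ring
      _ ≤ c₀ ^ 4 / 8 * H.card := by gcongr
      _ ≤ B.card := hBcard
      _ ≤ H'.card * L := by rwa [mul_comm]
  rw [Fintype.expect_eq_sum_div_card, le_div_iff₀ hN0]
  calc c₀ ^ 4 / 8 * c₀ / L * c₀ * N = c₀ ^ 4 / 8 * c₀ / L * N * c₀ := by ring
    _ ≤ H'.card * c₀ := by gcongr
    _ = ∑ h ∈ H', c₀ := by simp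
    _ ≤ ∑ h ∈ H', ‖coeff (mulDeriv f h) (M *ᵥ h + b)‖ ^ 2 := by
      refine Finset.sum_le_sum fun h hh => ?_
      obtain ⟨hhH, hh⟩ := Finset.mem_filter.1 hh
      rw [← hh]
      exact (Finset.mem_filter.1 hhH).2
    _ ≤ _ := Finset.sum_le_sum_of_subset_of_nonneg (Finset.subset_univ _)
      fun _ _ _ => by positivity

theorem mainTheorem2 (δ : ℝ) (hδ : 0 < δ) :
    ∃ c : ℝ, 0 < c ∧
      ∀ (n : ℕ) (f : (Fin n → ZMod 5) → ℝ),
        (∀ x, f x ∈ Set.Icc (-1 : ℝ) 1) → δ ≤ gowersU3Norm f →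
          ∃ (M : Matrix (Fin n) (Fin n) (ZMod 5)) (r : Fin n → ZMod 5),
            c ≤ ‖𝔼 x : Fin n → ZMod 5, (f x : ℂ) * quadraticPhase M r x‖ := by
  -- The derivative coefficients have mean square at least `cubeAverage f ^ 2 ≥ (δ ^ 8) ^ 2`, which
  -- must equal `2 * c₀`.
  obtain ⟨c, hc, hmain⟩ := exists_affine_deriv_coeff (c₀ := (δ ^ 8) ^ 2 / 2) (by positivity)
  refine ⟨c ^ 5, by positivity, fun n f hf hU => ?_⟩
  have hf' (x) : |f x| ≤ 1 := abs_le.2 (hf x)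
  obtain ⟨φ, hφ⟩ := exists_deriv_coeff hf'
  have h1 : δ ^ 8 ≤ cubeAverage f := by
    rw [← gowersU3Norm_pow_eight]
    exact pow_le_pow_left₀ hδ.le hU 8
  have h2 : (δ ^ 8) ^ 2 ≤ cubeAverage f ^ 2 := pow_le_pow_left₀ (by positivity) h1 2
  obtain ⟨M, b, hMb⟩ := hmain n f hf' φ (by linarith)
  obtain ⟨S, b', hS, hSb⟩ := exists_symmetric hf' M b hc hMb
  obtain ⟨Q, r, hQ⟩ := exists_quadraticPhase hf' hS b'
  exact ⟨Q, r, hSb.trans hQ⟩
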